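/- Let $2<n<\omega$. For an ordinal $\alpha\le\omega$, let $\mathsf{CA}_\alpha$ be the class of cylindric algebras of dimension $\alpha$. For $\mathfrak B\in\mathsf{CA}_\omega$, let $\mathfrak{Nr}_n\mathfrak B$ be the neat $n$-reduct of $\mathfrak B$: the $n$-dimensional cylindric algebra with universe $\{x\in B : \mathsf c_i x=x \text{ for all } n\le i<\omega\}$ and with the Boolean operations, the cylindrifications $\mathsf c_i$ ($i<n$) and the diagonal elements $\mathsf d_{ij}$ ($i,j<n$) of $\mathfrak B$. Let $\mathsf{Nr}_n\mathsf{CA}_\omega$ be the class of all algebras isomorphic to $\mathfrak{Nr}_n\mathfrak B$ for some $\mathfrak B\in\mathsf{CA}_\omega$. Let $\mathsf{RCA}_n$ be the class of representable cylindric algebras of dimension $n$, i.e. the algebras isomorphic to a subdirect product of cylindric set algebras of dimension $n$ (subalgebras of full cylindric set algebras $\wp({}^nU)$). Let $K$ be any class of algebras with $\mathsf{Nr}_n\mathsf{CA}_\omega\subseteq K\subseteq\mathsf{RCA}_n$, and let $ELK$ be its elementary closure, i.e. the smallest elementary class containing $K$, which is the class of all models of the first-order theory of $K$ in the language of $n$-dimensional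 cylindric algebras. Then $ELK$ is not finitely axiomatizable: there is no finite set of first-order sentences in this language whose class of models is $ELK$. -/

import Mathlib

open FirstOrder FirstOrder.Language CategoryTheory

universe u v

/-- The operation symbols of cylindric algebras whose dimensions are the elements of `ι`. -/
inductive CAFunc (ι : Type) : ℕ → Type
  | join : CAFunc ι 2
  | meet : CAFunc ι 2
  | neg : CAFunc ι 1
  | zero : CAFunc ι 0
  | one : CAFunc ι 0
  | cyl (i : ι) : CAFunc ι 1
  | diag (i j : ι) : CAFunc ι 0

/-- The first-order language of cylindric algebras of dimension `ι`: `+, ·, -, 0, 1`, the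
cylindrifications `c_i` and the diagonal elements `d_ij`; no relation symbols but equality. -/
abbrev caLang (ι : Type) : FirstOrder.Language := ⟨CAFunc ι, fun _ => Empty⟩

namespace CA

section Operations

variable {ι : Type} {A : Type u} [(caLang ι).Structure A]

variable (ι) in
def join (x y : A) : A := Structure.funMap (L := caLang ι) CAFunc.join ![x, y]

variable (ι) in
def meet (x y : A) : A := Structure.funMap (L := caLang ι) CAFunc.meet ![x, y]

variable (ι) in
def neg (x : A) : A := Structure.funMap (L := caLang ι) CAFunc.neg ![x]

variable (ι A) in
def zero : A := Structure.funMap (L := caLang ι) CAFunc.zero ![]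

variable (ι A) in
def one : A := Structure.funMap (L := caLang ι) CAFunc.one ![]

def cyl (i : ι) (x : A) : A := Structure.funMap (L := caLang ι) (CAFunc.cyl i) ![x]

variable (A) in
def diag (i j : ι) : A := Structure.funMap (L := caLang ι) (CAFunc.diag i j) ![]

end Operations

/-- `A` is a cylindric algebra of dimension `ι`: a Boolean algebra (possibly with one element)
satisfying the seven cylindric axioms. -/
structure IsCA (ι : Type) (A : Type u) [(caLang ι).Structure A] : Prop where
  join_comm : ∀ x y : A, join ι x y = join ι y x
  meet_comm : ∀ x y : A, meet ι x y = meet ι y x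
  join_assoc : ∀ x y z : A, join ι (join ι x y) z = join ι x (join ι y z)
  meet_assoc : ∀ x y z : A, meet ι (meet ι x y) z = meet ι x (meet ι y z)
  join_meet_self : ∀ x y : A, join ι x (meet ι x y) = x
  meet_join_self : ∀ x y : A, meet ι x (join ι x y) = x
  meet_join_distrib : ∀ x y z : A, meet ι x (join ι y z) = join ι (meet ι x y) (meet ι x z)
  join_zero : ∀ x : A, join ι x (zero ι A) = x
  meet_one : ∀ x : A, meet ι x (one ι A) = x
  join_neg : ∀ x : A, join ι x (neg ι x) = one ι A
  meet_neg : ∀ x : A, meet ι x (neg ι x) = zero ι A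
  cyl_zero : ∀ i : ι, cyl i (zero ι A) = zero ι A
  le_cyl : ∀ (i : ι) (x : A), join ι x (cyl i x) = cyl i x
  cyl_meet_cyl : ∀ (i : ι) (x y : A), cyl i (meet ι x (cyl i y)) = meet ι (cyl i x) (cyl i y)
  cyl_comm : ∀ (i j : ι) (x : A), cyl i (cyl j x) = cyl j (cyl i x)
  diag_self : ∀ i : ι, diag A i i = one ι A
  diag_eq : ∀ i j k : ι, k ≠ i → k ≠ j →
    diag A i j = cyl k (meet ι (diag A i k) (diag A k j))
  cyl_diag : ∀ (i j : ι) (x : A), i ≠ j →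
    meet ι (cyl i (meet ι (diag A i j) x)) (cyl i (meet ι (diag A i j) (neg ι x))) = zero ι A

namespace IsCA

variable {ι : Type} {A : Type u} [(caLang ι).Structure A]

/-- The Boolean reduct of a cylindric algebra. -/
abbrev boolean (h : IsCA ι A) : BooleanAlgebra A :=
  letI lat : Lattice A :=
    @Lattice.mk' A ⟨join ι⟩ ⟨meet ι⟩ h.join_comm h.join_assoc h.meet_comm h.meet_assoc
      h.join_meet_self h.meet_join_self
  letI dl : DistribLattice A :=
    DistribLattice.ofInfSupLe fun x y z => le_of_eq (h.meet_join_distrib x y z)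
  { dl with
    compl := neg ι
    top := one ι A
    bot := zero ι A
    inf_compl_le_bot := fun x => le_of_eq (h.meet_neg x)
    top_le_sup_compl := fun x => le_of_eq (h.join_neg x).symm
    le_top := fun x => by
      have := h.meet_one x
      exact inf_eq_left.mp this
    bot_le := fun x => by
      have := h.join_zero x
      exact sup_eq_left.mp this }

theorem cyl_one (h : IsCA ι A) (i : ι) : cyl i (one ι A) = one ι A := by
  let _ := h.boolean
  have := h.le_cyl i (one ι A)
  exact top_le_iff.mp (sup_eq_right.mp this)

theorem cyl_cyl (h : IsCA ι A) (i : ι) (x : A) : cyl i (cyl i x) = cyl i x := by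
  have := h.cyl_meet_cyl i (one ι A) x
  rwa [h.cyl_one, h.meet_comm _ (cyl i x), h.meet_one] at this

theorem cyl_meet_of_fixed (h : IsCA ι A) {i : ι} {x y : A} (hx : cyl i x = x) (hy : cyl i y = y) :
    cyl i (meet ι x y) = meet ι x y := by
  have := h.cyl_meet_cyl i x y
  rwa [hx, hy] at this

theorem cyl_neg_of_fixed (h : IsCA ι A) {i : ι} {x : A} (hx : cyl i x = x) :
    cyl i (neg ι x) = neg ι x := by
  let _ := h.boolean
  have h1 : meet ι (cyl i (neg ι x)) x = zero ι A := by
    have := h.cyl_meet_cyl i (neg ι x) x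
    rw [hx, h.meet_comm (neg ι x) x, h.meet_neg, h.cyl_zero] at this
    exact this.symm
  have h2 : cyl i (neg ι x) ≤ xᶜ := Disjoint.le_compl_right (disjoint_iff.mpr h1)
  exact le_antisymm h2 (sup_eq_right.mp (h.le_cyl i (neg ι x)))

theorem cyl_join_of_fixed (h : IsCA ι A) {i : ι} {x y : A} (hx : cyl i x = x) (hy : cyl i y = y) :
    cyl i (join ι x y) = join ι x y := by
  let _ := h.boolean
  have e : join ι x y = neg ι (meet ι (neg ι x) (neg ι y)) := by
    change x ⊔ y = (xᶜ ⊓ yᶜ)ᶜ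
    simp
  rw [e]
  exact h.cyl_neg_of_fixed (h.cyl_meet_of_fixed (h.cyl_neg_of_fixed hx) (h.cyl_neg_of_fixed hy))

theorem cyl_diag_of_ne (h : IsCA ι A) {i j k : ι} (hi : k ≠ i) (hj : k ≠ j) :
    cyl k (diag A i j) = diag A i j := by
  rw [h.diag_eq i j k hi hj, h.cyl_cyl]

end IsCA

/-- The inclusion of the language of dimension `n` into the language of dimension `ω`. -/
def finLHom (n : ℕ) : caLang (Fin n) →ᴸ caLang ℕ where
  onFunction := fun
    | _, CAFunc.join => CAFunc.join
    | _, CAFunc.meet => CAFunc.meet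
    | _, CAFunc.neg => CAFunc.neg
    | _, CAFunc.zero => CAFunc.zero
    | _, CAFunc.one => CAFunc.one
    | _, CAFunc.cyl i => CAFunc.cyl (i : ℕ)
    | _, CAFunc.diag i j => CAFunc.diag (i : ℕ) (j : ℕ)
  onRelation := fun _ r => r.elim

/-- The neat `n`-reduct `Nr_n B` of a cylindric algebra `B` of dimension `ω`: the subalgebra of
the `n`-reduct of `B` consisting of all `x` with `c_i x = x` for all `i` with `n ≤ i < ω`. -/
def neatReduct (n : ℕ) (B : Type u) [(caLang ℕ).Structure B] (hB : IsCA ℕ B) :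
    letI := (finLHom n).reduct B
    (caLang (Fin n)).Substructure B :=
  letI := (finLHom n).reduct B
  { carrier := {x | ∀ i : ℕ, n ≤ i → cyl i x = x}
    fun_mem := by
      intro k f v hv i hi
      have key : ∀ (g : (caLang ℕ).Functions k) (w : Fin k → B),
          w = v → (finLHom n).onFunction f = g →
          cyl i (Structure.funMap (L := caLang ℕ) g w) = Structure.funMap (L := caLang ℕ) g w := by
        rintro g w rfl rfl
        cases f with
        | join =>
          have e : w = ![w 0, w 1] := by ext a; fin_cases a <;> rfl
          rw [e]; exact hB.cyl_join_of_fixed (hv 0 i hi) (hv 1 i hi)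
        | meet =>
          have e : w = ![w 0, w 1] := by ext a; fin_cases a <;> rfl
          rw [e]; exact hB.cyl_meet_of_fixed (hv 0 i hi) (hv 1 i hi)
        | neg =>
          have e : w = ![w 0] := by ext a; fin_cases a; rfl
          rw [e]; exact hB.cyl_neg_of_fixed (hv 0 i hi)
        | zero => rw [Subsingleton.elim w (![] : Fin 0 → B)]; exact hB.cyl_zero i
        | one => rw [Subsingleton.elim w (![] : Fin 0 → B)]; exact hB.cyl_one i
        | cyl j =>
          have e : w = ![w 0] := by ext a; fin_cases a; rfl
          rw [e]
          change cyl i (cyl (j : ℕ) (w 0)) = cyl (j : ℕ) (w 0)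
          rw [hB.cyl_comm, hv 0 i hi]
        | diag j l =>
          rw [Subsingleton.elim w (![] : Fin 0 → B)]
          exact hB.cyl_diag_of_ne (by omega) (by omega)
      exact key _ v rfl rfl }

/-- The class `Nr_n CA_ω` of all algebras (isomorphic to) `Nr_n B` with `B ∈ CA_ω`. -/
def NrCAOmega (n : ℕ) : Set (Bundled.{u} (caLang (Fin n)).Structure) :=
  {A | ∃ (B : Bundled.{u} (caLang ℕ).Structure) (hB : IsCA ℕ B),
    letI := (finLHom n).reduct B
    Nonempty (A ≃[caLang (Fin n)] neatReduct n B hB)}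

/-- The universe of the full cylindric set algebra of dimension `ι` with base `U`: all subsets
of the Cartesian power `U ^ ι`. -/
def FullCs (ι : Type) (U : Type u) : Type u := Set (ι → U)

/-- The operations of the full cylindric set algebra with base `U`: union, intersection,
complement, `∅`, the full power, `c_i X = {s | some t ∈ X agrees with s off i}` and
`d_ij = {s | s i = s j}`. -/
def fullCsFun (ι : Type) (U : Type u) :
    {k : ℕ} → CAFunc ι k → (Fin k → Set (ι → U)) → Set (ι → U)
  | _, CAFunc.join, v => v 0 ∪ v 1
  | _, CAFunc.meet, v => v 0 ∩ v 1
  | _, CAFunc.neg, v => (v 0)ᶜ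
  | _, CAFunc.zero, _ => ∅
  | _, CAFunc.one, _ => Set.univ
  | _, CAFunc.cyl i, v => {s | ∃ t ∈ v 0, ∀ j, j ≠ i → t j = s j}
  | _, CAFunc.diag i j, _ => {s | s i = s j}

instance (ι : Type) (U : Type u) : (caLang ι).Structure (FullCs ι U) where
  funMap := fullCsFun ι U
  RelMap := fun r => r.elim

/-- The direct product of a family of algebras, with coordinatewise operations. -/
def DirectProd {I : Type v} (M : I → Type u) : Type (max u v) := ∀ k, M k

instance (ι : Type) {I : Type v} (M : I → Type u) [∀ k, (caLang ι).Structure (M k)] :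
    (caLang ι).Structure (DirectProd M) where
  funMap := fun f v k => Structure.funMap f fun a => v a k
  RelMap := fun r => r.elim

/-- The class `RCA_ι` of representable cylindric algebras of dimension `ι`: those isomorphic to a
subdirect product of cylindric set algebras of dimension `ι` (subalgebras of full ones), that is,
to a subalgebra of a direct product of full cylindric set algebras. -/
def RCA (ι : Type) : Set (Bundled.{u} (caLang ι).Structure) :=
  {A | ∃ (I : Type u) (U : I → Type u),
    Nonempty (A ↪[caLang ι] DirectProd fun k => FullCs ι (U k))}

end CA

/-- The first-order theory of a class of structures. -/
def theoryOf {L : FirstOrder.Language.{0, 0}} (K : Set (Bundled.{u} L.Structure)) : L.Theory :=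
  {φ | ∀ M ∈ K, M ⊨ φ}

/-- The class of all models of a theory. -/
def modelsOf {L : FirstOrder.Language.{0, 0}} (T : L.Theory) : Set (Bundled.{u} L.Structure) :=
  {M | M ⊨ T}

/-- The elementary closure `EL K`: the least elementary class containing `K`, that is, the class
of all models of the first-order theory of `K`. -/
def elementaryClosure {L : FirstOrder.Language.{0, 0}} (K : Set (Bundled.{u} L.Structure)) :
    Set (Bundled.{u} L.Structure) :=
  modelsOf (theoryOf K)

/-- A class of structures is finitely axiomatizable if it is the class of all models of a finite
set of first-order sentences. -/
def IsFinitelyAxiomatizable {L : FirstOrder.Language.{0, 0}}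
    (C : Set (Bundled.{u} L.Structure)) : Prop :=
  ∃ T : L.Theory, T.Finite ∧ C = modelsOf T

/-! The class is shown not to be closed under finite approximation: finite algebras outside `ELK`
have an ultraproduct inside `K`.

Fix `m ≥ n` and a finite set of labels coloured by exactly `m` colours. A net is a labelling of the
pairs from `m` points (points may coincide) without monochromatic triangles. Sets of nets form an
algebra in which `c_i` changes the point `i`. With as many colours as points, a new edge can always
be given a colour that closes no monochromatic triangle (`AgreeOff.amalgamate`), so
cylindrifications commute and the cylindric axioms hold for indices below `m`. The finite algebra
`A` of sets depending only on the first `n` points is `NetReduct`.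

`A` is not representable when there are many labels. In a set algebra, every label `x` must occur on
an edge leaving a fixed base point (`cyl_edge_one`), so the base has at least as many points as
there are labels. Yet its pairs carry `m` colours without a monochromatic triangle (`edge_triangle`,
`exists_coloring_of_hom`), and Ramsey's theorem bounds the size of such a base.

As `m → ∞`, every single axiom of `CA_ω` holds in almost all of the algebras of sets of nets, so
their ultraproduct is in `CA_ω`. The ultraproduct of the `n`-dimensional parts is a neat reduct of a
subalgebra of it (`netReduct_product_mem_NrCAOmega`), hence lies in `K`.

A finite axiomatization of `ELK` would therefore hold in some `A` by Łoś. But embeddability of the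
finite `A` is expressed by one sentence, true in `A` and false throughout `K ⊆ RCA_n`, so `A` is not
in `ELK`. -/

namespace CA

/-! ### Nets, their amalgamation and extension. -/

section Nets

variable {m : ℕ} {κ : Type u} {γ : Type}

/-- A net with `m` points: `none` is the label of pairs of equal points, and distinct points carry
symmetric labels in `κ` without monochromatic triangles for the colouring `col` of the labels. -/
structure IsNet (col : κ → γ) (ρ : Fin m → Fin m → Option κ) : Prop where
  refl : ∀ a, ρ a a = none
  symm : ∀ a b, ρ a b = ρ b a
  congr : ∀ a b c, ρ a b = none → ρ a c = ρ b c
  triangle : ∀ a b c x y z, ρ a b = some x → ρ b c = some y → ρ a c = some z →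
    col x = col y → col x ≠ col z

/-- The nets with `m` points. -/
def Net (m : ℕ) (col : κ → γ) : Type u := {ρ : Fin m → Fin m → Option κ // IsNet col ρ}

/-- Two nets agree off the point `i`. -/
def AgreeOff {col : κ → γ} (i : ℕ) (ρ σ : Net m col) : Prop :=
  ∀ a b : Fin m, (a : ℕ) ≠ i → (b : ℕ) ≠ i → ρ.1 a b = σ.1 a b

section

variable {col : κ → γ} {ρ σ τ : Net m col} {i j : ℕ}

instance [Finite κ] : Finite (Net m col) := by
  unfold Net; infer_instance

theorem AgreeOff.refl (i : ℕ) (ρ : Net m col) : AgreeOff i ρ ρ := fun _ _ _ _ => rfl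

theorem AgreeOff.symm (h : AgreeOff i ρ σ) : AgreeOff i σ ρ := fun a b ha hb => (h a b ha hb).symm

theorem AgreeOff.trans (h : AgreeOff i ρ σ) (h' : AgreeOff i σ τ) : AgreeOff i ρ τ :=
  fun a b ha hb => (h a b ha hb).trans (h' a b ha hb)

theorem AgreeOff.eq_of_le (hi : m ≤ i) (h : AgreeOff i ρ σ) : ρ = σ := by
  apply Subtype.ext
  funext a b
  exact h a b (by omega) (by omega)

/-- The net obtained by moving points along a map. -/
def Net.comap (ρ : Net m col) (f : Fin m → Fin m) : Net m col :=
  ⟨fun a b => ρ.1 (f a) (f b), fun _ => ρ.2.refl _, fun _ _ => ρ.2.symm _ _,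
    fun _ _ _ => ρ.2.congr _ _ _, fun _ _ _ => ρ.2.triangle _ _ _⟩

/-- Off `j` the net `σ'` is forced to be `ρ`, and off `i` to be `τ`; these agree on the overlap
because both agree with `σ` there. Only the pair `i, j` is free. This is commutativity of
cylindrifications in terms of nets. -/
theorem AgreeOff.amalgamate {col : κ → Fin m} (hcol : Function.Surjective col)
    {ρ σ τ : Net m col} {i j : Fin m} (hρσ : AgreeOff i ρ σ) (hστ : AgreeOff j σ τ) :
    ∃ σ' : Net m col, AgreeOff j ρ σ' ∧ AgreeOff i σ' τ := by
  by_cases hij : i = j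
  · subst hij
    exact ⟨ρ, AgreeOff.refl _ _, hρσ.trans hστ⟩
  have hag : ∀ a b, a ≠ i → b ≠ i → a ≠ j → b ≠ j → ρ.1 a b = τ.1 a b := fun a b h1 h2 h3 h4 =>
    (hρσ a b (by omega) (by omega)).trans (hστ a b (by omega) (by omega))
  -- If `i` coincides in `ρ` with a third point `p`, the pair `i, j` has no freedom: `i` must be
  -- placed on `p` in `τ`. The case of `j` in `τ` is symmetric.
  by_cases h1 : ∃ p, p ≠ i ∧ p ≠ j ∧ ρ.1 i p = none
  · obtain ⟨p, hpi, hpj, hp⟩ := h1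
    refine ⟨τ.comap (Function.update id i p), fun a b ha hb => ?_, fun a b ha hb => ?_⟩
    · have ha' : a ≠ j := by omega
      have hb' : b ≠ j := by omega
      have := ρ.2.congr _ _ b hp
      have := ρ.2.congr _ _ p hp
      have := ρ.2.symm a i
      have := ρ.2.symm a p
      have := ρ.2.congr _ _ a hp
      have := ρ.2.refl
      have := τ.2.refl
      simp only [Net.comap, Function.update_apply, id]
      grind
    · have ha' : a ≠ i := by omega
      have hb' : b ≠ i := by omega
      simp [Net.comap, ha', hb']
  by_cases h2 : ∃ p, p ≠ i ∧ p ≠ j ∧ τ.1 j p = none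
  · obtain ⟨p, hpi, hpj, hp⟩ := h2
    refine ⟨ρ.comap (Function.update id j p), fun a b ha hb => ?_, fun a b ha hb => ?_⟩
    · have ha' : a ≠ j := by omega
      have hb' : b ≠ j := by omega
      simp [Net.comap, ha', hb']
    · have ha' : a ≠ i := by omega
      have hb' : b ≠ i := by omega
      have := τ.2.congr _ _ b hp
      have := τ.2.congr _ _ p hp
      have := τ.2.symm a j
      have := τ.2.symm a p
      have := τ.2.congr _ _ a hp
      have := ρ.2.refl
      have := τ.2.refl
      simp only [Net.comap, Function.update_apply, id]
      grind
  push Not at h1 h2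
  -- The other `m - 1` points use at most `m - 1` colours on their edges to `i`, so one of the `m`
  -- colours is unused. In `f` below, the value `i` for a missing label is an arbitrary colour.
  obtain ⟨c, hc⟩ : ∃ x : κ, ∀ p y, p ≠ i → ρ.1 i p = some y → col y ≠ col x := by
    classical
    let f : {p // p ≠ i} → Fin m := fun p => (ρ.1 i p).elim i col
    have hf : ¬ Function.Surjective f := fun hs => by
      have := Fintype.card_le_of_surjective f hs
      simp only [Fintype.card_fin, ne_eq, Fintype.card_subtype_compl, Fintype.card_unique] at this
      omega
    simp only [Function.Surjective, not_forall, not_exists] at hf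
    obtain ⟨d, hd⟩ := hf
    obtain ⟨x, rfl⟩ := hcol d
    refine ⟨x, fun p y hp hy he => hd ⟨p, hp⟩ ?_⟩
    simp [f, hy, he]
  let s : Fin m → Fin m → Option κ := fun a b =>
    if a ≠ j ∧ b ≠ j then ρ.1 a b else if a ≠ i ∧ b ≠ i then τ.1 a b else some c
  have hs1 : ∀ a b, a ≠ j → b ≠ j → s a b = ρ.1 a b := fun a b ha hb => by simp [s, ha, hb]
  have hs2 : ∀ a b, a ≠ i → b ≠ i → s a b = τ.1 a b := fun a b ha hb => by
    simp only [s]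
    split_ifs with h
    · exact hag a b ha hb h.1 h.2
    · rfl
    · simp_all
  have hs3 : s i j = some c := by simp [s, hij]
  have hs4 : s j i = some c := by simp [s, hij]
  have hss : ∀ a b, s a b = s b a := fun a b => by
    have := ρ.2.symm a b
    have := τ.2.symm a b
    grind
  refine ⟨⟨s, ?_, hss, ?_, ?_⟩, fun a b ha hb => (hs1 a b (by omega) (by omega)).symm,
    fun a b ha hb => hs2 a b (by omega) (by omega)⟩
  · intro a
    have := ρ.2.refl a
    have := τ.2.refl a
    grind
  · intro a b d hab
    have := ρ.2.congr a b d
    have := τ.2.congr a b d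
    have := ρ.2.symm
    have := τ.2.symm
    clear hs3 hs4
    by_cases hj : a ≠ j ∧ b ≠ j ∧ d ≠ j
    · grind
    by_cases hi : a ≠ i ∧ b ≠ i ∧ d ≠ i
    · grind
    grind
  · intro a b d x y z hx hy hz hxy
    have hn : ∀ p y, p ≠ i → s i p = some y → p ≠ j → col y ≠ col c := fun p y hp hy hj =>
      hc p y hp (by rw [← hs1 i p hij hj, hy])
    have := ρ.2.triangle a b d x y z
    have := τ.2.triangle a b d x y z
    have hd : ∀ a x, s a a ≠ some x := fun a x => by
      have := ρ.2.refl a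
      have := τ.2.refl a
      grind
    by_cases hj : a ≠ j ∧ b ≠ j ∧ d ≠ j
    · grind
    by_cases hi : a ≠ i ∧ b ≠ i ∧ d ≠ i
    · grind
    have h1 : a ≠ b := fun h => hd a x (by grind)
    have h2 : b ≠ d := fun h => hd d y (by grind)
    have h3 : a ≠ d := fun h => hd d z (by grind)
    have e1 := hss a b
    have e2 := hss b d
    have e3 := hss a d
    clear_value s
    clear this hd hs1 hs2 hc hag hρσ hστ
    grind

/-- The point `j` is replaced by a new point whose edges to distinct points have distinct colours,
so no triangle through it is monochromatic. There are enough colours, since there are at most `m`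
classes of coinciding points. -/
theorem exists_agreeOff_label {col : κ → Fin m} (hcol : Function.Surjective col)
    (ρ : Net m col) {i j : Fin m} (hij : i ≠ j) (x : κ) :
    ∃ σ : Net m col, AgreeOff j σ ρ ∧ σ.1 i j = some x := by
  classical
  let S : Setoid (Fin m) := ⟨fun a b => ρ.1 a b = none, ρ.2.refl,
    fun {a b} h => (ρ.2.symm b a).trans h, fun {a b c} h h' => (ρ.2.congr a b c h).trans h'⟩
  let r : Fin m → Fin m := fun p => (Quotient.mk S p).out
  have hr : ∀ p q, ρ.1 p q = none ↔ r p = r q := fun p q =>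
    ⟨fun h => congrArg Quotient.out (Quotient.sound (s := S) h),
      fun h => Quotient.exact (s := S) (Quotient.out_injective h)⟩
  choose inv hinv using hcol
  -- The representative `r p` of the class of `p` serves as its colour; the transposition gives the
  -- class of `i` the colour of `x`.
  let l : Fin m → κ := fun p =>
    if r p = r i then x else inv (Equiv.swap (r i) (col x) (r p))
  have hl : ∀ p, col (l p) = Equiv.swap (r i) (col x) (r p) := fun p => by
    simp only [l]
    split_ifs with h
    · simp [h]
    · rw [hinv]
  have hl1 : ∀ p q, ρ.1 p q = none → l p = l q := fun p q h => by
    simp only [l, (hr p q).1 h]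
  have hl2 : ∀ p q y, ρ.1 p q = some y → col (l p) ≠ col (l q) := fun p q y h => by
    rw [hl, hl, (Equiv.injective _).ne_iff]
    intro h'
    rw [(hr p q).2 h'] at h
    cases h
  have hli : l i = x := by simp [l]
  let s : Fin m → Fin m → Option κ := fun a b =>
    if a = j then if b = j then none else some (l b) else if b = j then some (l a) else ρ.1 a b
  have := ρ.2.refl
  have := ρ.2.symm
  refine ⟨⟨s, ?_, ?_, ?_, ?_⟩, ?_, ?_⟩
  · intro a
    grind
  · intro a b
    grind
  · intro a b c
    have := ρ.2.congr a b c
    grind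
  · intro a b c x y z
    have := ρ.2.triangle a b c x y z
    grind
  · intro a b ha hb
    have ha' : a ≠ j := by omega
    have hb' : b ≠ j := by omega
    simp [s, ha', hb']
  · simp [s, hij, hli]

end

end Nets


/-! ### The algebra of all sets of nets. -/

section NetAlg

variable {m : ℕ} {κ : Type u} {γ : Type}

/-- The algebra of all sets of nets with `m` points. -/
def NetAlg (m : ℕ) (col : κ → γ) : Type u := Set (Net m col)

/-- The operations on sets of nets; `c_i` is the identity for `m ≤ i`. -/
def netFun (col : κ → γ) :
    {k : ℕ} → CAFunc ℕ k → (Fin k → Set (Net m col)) → Set (Net m col)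
  | _, CAFunc.join, v => v 0 ∪ v 1
  | _, CAFunc.meet, v => v 0 ∩ v 1
  | _, CAFunc.neg, v => (v 0)ᶜ
  | _, CAFunc.zero, _ => ∅
  | _, CAFunc.one, _ => Set.univ
  | _, CAFunc.cyl i, v => {ρ | ∃ σ ∈ v 0, AgreeOff i σ ρ}
  -- For an index from `m` on the condition is vacuous and the diagonal is everything.
  | _, CAFunc.diag i j, _ => {ρ | ∀ a b : Fin m, (a : ℕ) = i → (b : ℕ) = j → ρ.1 a b = none}

instance (col : κ → γ) : (caLang ℕ).Structure (NetAlg m col) where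
  funMap := netFun col
  RelMap := fun r => r.elim

variable {col : κ → γ}

instance : Inhabited (NetAlg m col) := ⟨(∅ : Set (Net m col))⟩

instance [Finite κ] : Finite (NetAlg m col) := inferInstanceAs (Finite (Set (Net m col)))

instance : Membership (Net m col) (NetAlg m col) := inferInstanceAs (Membership _ (Set _))

namespace NetAlg

variable {X Y : NetAlg m col} {ρ : Net m col} {i j k : ℕ}

@[ext] theorem ext (h : ∀ ρ, ρ ∈ X ↔ ρ ∈ Y) : X = Y := Set.ext h

@[simp] theorem mem_join : ρ ∈ join ℕ X Y ↔ ρ ∈ X ∨ ρ ∈ Y := Iff.rfl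
@[simp] theorem mem_meet : ρ ∈ meet ℕ X Y ↔ ρ ∈ X ∧ ρ ∈ Y := Iff.rfl
@[simp] theorem mem_neg : ρ ∈ neg ℕ X ↔ ρ ∉ X := Iff.rfl
@[simp] theorem mem_zero : ρ ∈ zero ℕ (NetAlg m col) ↔ False := Iff.rfl
@[simp] theorem mem_one : ρ ∈ one ℕ (NetAlg m col) ↔ True := Iff.rfl
theorem mem_cyl : ρ ∈ cyl i X ↔ ∃ σ ∈ X, AgreeOff i σ ρ := Iff.rfl
theorem mem_diag : ρ ∈ diag (NetAlg m col) i j ↔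
    ∀ a b : Fin m, (a : ℕ) = i → (b : ℕ) = j → ρ.1 a b = none := Iff.rfl
theorem mem_diag_fin {a b : Fin m} : ρ ∈ diag (NetAlg m col) (a : ℕ) (b : ℕ) ↔ ρ.1 a b = none :=
  ⟨fun h => h a b rfl rfl, fun h a' b' ha hb => by rwa [Fin.ext ha, Fin.ext hb]⟩

theorem cyl_zero (i : ℕ) : cyl i (zero ℕ (NetAlg m col)) = zero ℕ (NetAlg m col) := by
  ext; simp [mem_cyl]

theorem cyl_one (i : ℕ) : cyl i (one ℕ (NetAlg m col)) = one ℕ (NetAlg m col) := by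
  ext ρ; simpa [mem_cyl] using ⟨ρ, AgreeOff.refl _ _⟩

theorem le_cyl (i : ℕ) (X : NetAlg m col) : join ℕ X (cyl i X) = cyl i X := by
  ext ρ
  simp only [mem_join, or_iff_right_iff_imp]
  exact fun h => ⟨ρ, h, AgreeOff.refl _ _⟩

theorem cyl_meet_cyl (i : ℕ) (X Y : NetAlg m col) :
    cyl i (meet ℕ X (cyl i Y)) = meet ℕ (cyl i X) (cyl i Y) := by
  ext ρ
  constructor
  · rintro ⟨σ, ⟨h1, τ, h2, h3⟩, h⟩
    exact ⟨⟨σ, h1, h⟩, ⟨τ, h2, h3.trans h⟩⟩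
  · rintro ⟨⟨σ, h1, h⟩, ⟨τ, h2, h3⟩⟩
    exact ⟨σ, ⟨h1, τ, h2, h3.trans h.symm⟩, h⟩

theorem cyl_of_le (hi : m ≤ i) (X : NetAlg m col) : cyl i X = X := by
  ext ρ
  constructor
  · rintro ⟨σ, h1, h⟩
    rwa [← h.eq_of_le hi]
  · exact fun h => ⟨ρ, h, AgreeOff.refl _ _⟩

theorem cyl_comm {col : κ → Fin m} (hcol : Function.Surjective col) (i j : ℕ)
    (X : NetAlg m col) : cyl i (cyl j X) = cyl j (cyl i X) := by
  suffices h : ∀ (i j : ℕ) (ρ : Net m col), ρ ∈ cyl i (cyl j X) → ρ ∈ cyl j (cyl i X) from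
    ext fun ρ => ⟨h i j ρ, h j i ρ⟩
  intro i j ρ h
  by_cases hi : m ≤ i
  · rwa [cyl_of_le hi] at h ⊢
  by_cases hj : m ≤ j
  · rwa [cyl_of_le hj] at h ⊢
  obtain ⟨σ, ⟨τ, h1, h2⟩, h3⟩ := h
  obtain ⟨σ', h4, h5⟩ := AgreeOff.amalgamate hcol (i := ⟨j, by omega⟩) (j := ⟨i, by omega⟩) h2 h3
  exact ⟨σ', ⟨τ, h1, h4⟩, h5⟩

theorem cyl_meet_of_fixed (hX : cyl i X = X) (hY : cyl i Y = Y) :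
    cyl i (meet ℕ X Y) = meet ℕ X Y := by
  have := cyl_meet_cyl i X Y
  rwa [hX, hY] at this

theorem cyl_join_of_fixed (hX : cyl i X = X) (hY : cyl i Y = Y) :
    cyl i (join ℕ X Y) = join ℕ X Y := by
  conv_rhs => rw [← hX, ← hY]
  ext ρ
  simp only [mem_cyl, mem_join]
  grind

theorem cyl_neg_of_fixed (hX : cyl i X = X) : cyl i (neg ℕ X) = neg ℕ X := by
  ext ρ
  constructor
  · rintro ⟨σ, h1, h2⟩ h3
    refine h1 ?_
    rw [← hX]
    exact ⟨ρ, h3, h2.symm⟩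
  · exact fun h => ⟨ρ, h, AgreeOff.refl _ _⟩

theorem diag_self (i : ℕ) : diag (NetAlg m col) i i = one ℕ (NetAlg m col) := by
  ext ρ
  refine ⟨fun _ => trivial, fun _ a b ha hb => ?_⟩
  rw [Fin.ext (ha.trans hb.symm)]
  exact ρ.2.refl b

theorem cyl_diag_of_ne (hi : k ≠ i) (hj : k ≠ j) :
    cyl k (diag (NetAlg m col) i j) = diag (NetAlg m col) i j := by
  ext ρ
  constructor
  · rintro ⟨σ, h1, h2⟩ a b ha hb
    rw [← h2 a b (by omega) (by omega)]
    exact h1 a b ha hb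
  · exact fun h => ⟨ρ, h, AgreeOff.refl _ _⟩

theorem diag_eq (hi : i < m) (hj : j < m) (hk : k < m) (hki : k ≠ i) (hkj : k ≠ j) :
    diag (NetAlg m col) i j =
      cyl k (meet ℕ (diag (NetAlg m col) i k) (diag (NetAlg m col) k j)) := by
  lift i to Fin m using hi
  lift j to Fin m using hj
  lift k to Fin m using hk
  ext ρ
  simp only [mem_cyl, mem_meet, mem_diag_fin]
  have hki' : i ≠ k := fun h => hki (by rw [h])
  have hkj' : j ≠ k := fun h => hkj (by rw [h])
  constructor
  · intro h
    refine ⟨ρ.comap (Function.update id k i), ⟨?_, ?_⟩, fun a b ha hb => ?_⟩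
    · simpa [Net.comap, hki'] using ρ.2.refl i
    · simpa [Net.comap, hkj'] using h
    · have ha' : a ≠ k := by omega
      have hb' : b ≠ k := by omega
      simp [Net.comap, ha', hb']
  · rintro ⟨σ, ⟨h1, h2⟩, h3⟩
    rw [← h3 i j (by omega) (by omega), σ.2.congr i k j h1, h2]

/-- A net in which `i` and `j` coincide is determined by its restriction to the points other than
`i`. -/
theorem cyl_diag (hi : i < m) (hj : j < m) (hij : i ≠ j) (X : NetAlg m col) :
    meet ℕ (cyl i (meet ℕ (diag (NetAlg m col) i j) X))
      (cyl i (meet ℕ (diag (NetAlg m col) i j) (neg ℕ X))) = zero ℕ (NetAlg m col) := by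
  lift i to Fin m using hi
  lift j to Fin m using hj
  have hij' : j ≠ i := fun h => hij (by rw [h])
  have key : ∀ σ τ : Net m col, AgreeOff i σ τ → σ.1 i j = none → τ.1 i j = none → σ = τ := by
    intro σ τ h hσ hτ
    have h1 : ∀ b, σ.1 i b = τ.1 i b := by
      intro b
      by_cases hb : b = i
      · rw [hb, σ.2.refl, τ.2.refl]
      · rw [σ.2.congr i j b hσ, τ.2.congr i j b hτ]
        exact h j b (by omega) (by omega)
    apply Subtype.ext
    funext a b
    by_cases ha : a = i
    · rw [ha, h1]
    by_cases hb : b = i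
    · rw [hb, σ.2.symm, τ.2.symm, h1]
    exact h a b (by omega) (by omega)
  ext ρ
  simp only [mem_cyl, mem_meet, mem_diag_fin, mem_neg, mem_zero, iff_false]
  rintro ⟨⟨σ, ⟨h1, h2⟩, h3⟩, ⟨τ, ⟨h4, h5⟩, h6⟩⟩
  exact h5 (key σ τ (h3.trans h6.symm) h1 h4 ▸ h2)

end NetAlg

/-- The subalgebra of dimension `n` of the algebra of sets of nets with `m` points formed by the
sets that are closed under changing the points from `n` on. -/
def netReduct (n : ℕ) {m : ℕ} {col : κ → Fin m} (hcol : Function.Surjective col) :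
    letI := (finLHom n).reduct (NetAlg m col)
    (caLang (Fin n)).Substructure (NetAlg m col) :=
  letI := (finLHom n).reduct (NetAlg m col)
  { carrier := {x | ∀ i : ℕ, n ≤ i → cyl i x = x}
    fun_mem := by
      intro k f v hv i hi
      have key : ∀ (g : (caLang ℕ).Functions k) (w : Fin k → NetAlg m col),
          w = v → (finLHom n).onFunction f = g →
          cyl i (Structure.funMap (L := caLang ℕ) g w) = Structure.funMap (L := caLang ℕ) g w := by
        rintro g w rfl rfl
        cases f with
        | join =>
          have e : w = ![w 0, w 1] := by ext a; fin_cases a <;> rfl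
          rw [e]; exact NetAlg.cyl_join_of_fixed (hv 0 i hi) (hv 1 i hi)
        | meet =>
          have e : w = ![w 0, w 1] := by ext a; fin_cases a <;> rfl
          rw [e]; exact NetAlg.cyl_meet_of_fixed (hv 0 i hi) (hv 1 i hi)
        | neg =>
          have e : w = ![w 0] := by ext a; fin_cases a; rfl
          rw [e]; exact NetAlg.cyl_neg_of_fixed (hv 0 i hi)
        | zero => exact NetAlg.cyl_zero i
        | one => exact NetAlg.cyl_one i
        | cyl j =>
          have e : w = ![w 0] := by ext a; fin_cases a; rfl
          rw [e]
          change cyl i (cyl (j : ℕ) (w 0)) = cyl (j : ℕ) (w 0)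
          rw [NetAlg.cyl_comm hcol, hv 0 i hi]
        | diag j l =>
          exact NetAlg.cyl_diag_of_ne (i := (j : ℕ)) (j := (l : ℕ)) (by omega) (by omega)
      exact key _ v rfl rfl }

end NetAlg


/-- Cylindric algebras are closed under subalgebras. -/
theorem IsCA.of_injective {ι : Type} {A : Type u} {B : Type v} [(caLang ι).Structure A]
    [(caLang ι).Structure B] (hB : IsCA ι B) (f : A → B) (hf : Function.Injective f)
    (hmap : ∀ (k : ℕ) (g : CAFunc ι k) (x : Fin k → A),
      f (Structure.funMap (L := caLang ι) g x) = Structure.funMap (L := caLang ι) g (f ∘ x)) :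
    IsCA ι A := by
  have vec1 : ∀ x : A, f ∘ ![x] = ![f x] := fun x => by ext a; fin_cases a; rfl
  have vec2 : ∀ x y : A, f ∘ ![x, y] = ![f x, f y] := fun x y => by ext a; fin_cases a <;> rfl
  have vec0 : f ∘ ![] = ![] := Subsingleton.elim _ _
  have hj : ∀ x y : A, f (join ι x y) = join ι (f x) (f y) := fun x y => by
    simp only [join, ← vec2]; exact hmap _ _ _
  have hm : ∀ x y : A, f (meet ι x y) = meet ι (f x) (f y) := fun x y => by
    simp only [meet, ← vec2]; exact hmap _ _ _
  have hn : ∀ x : A, f (neg ι x) = neg ι (f x) := fun x => by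
    simp only [neg, ← vec1]; exact hmap _ _ _
  have hc : ∀ (i : ι) (x : A), f (cyl i x) = cyl i (f x) := fun i x => by
    simp only [cyl, ← vec1]; exact hmap _ _ _
  have h0 : f (zero ι A) = zero ι B := by
    simp only [zero, ← vec0]; exact hmap _ _ _
  have h1 : f (one ι A) = one ι B := by
    simp only [one, ← vec0]; exact hmap _ _ _
  have hd : ∀ i j : ι, f (diag A i j) = diag B i j := fun i j => by
    simp only [diag, ← vec0]; exact hmap _ _ _
  constructor <;> intros <;> apply hf <;> simp only [hj, hm, hn, hc, h0, h1, hd]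
  · exact hB.join_comm _ _
  · exact hB.meet_comm _ _
  · exact hB.join_assoc _ _ _
  · exact hB.meet_assoc _ _ _
  · exact hB.join_meet_self _ _
  · exact hB.meet_join_self _ _
  · exact hB.meet_join_distrib _ _ _
  · exact hB.join_zero _
  · exact hB.meet_one _
  · exact hB.join_neg _
  · exact hB.meet_neg _
  · exact hB.cyl_zero _
  · exact hB.le_cyl _ _
  · exact hB.cyl_meet_cyl _ _ _
  · exact hB.cyl_comm _ _ _
  · exact hB.diag_self _
  · exact hB.diag_eq _ _ _ ‹_› ‹_›
  · exact hB.cyl_diag _ _ _ ‹_›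

/-! ### Operations of ultraproducts, computed on representatives. -/

section Ultraproduct

variable {α : Type} {U : Ultrafilter α} {ι : Type} {M : α → Type u}

/-- The element of the ultraproduct given by a family. -/
def germ (U : Ultrafilter α) (x : ∀ a, M a) : (U : Filter α).Product M :=
  (x : (U : Filter α).Product M)

theorem germ_eq {x y : ∀ a, M a} : germ U x = germ U y ↔ ∀ᶠ a in U, x a = y a := Quotient.eq''

theorem exists_germ_eq (x : (U : Filter α).Product M) : ∃ y, germ U y = x := Quotient.exists_rep x

variable [∀ a, (caLang ι).Structure (M a)]

theorem funMap_germ {k : ℕ} (f : CAFunc ι k) (x : Fin k → ∀ a, M a) :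
    Structure.funMap (L := caLang ι) f (fun i => germ U (x i)) =
      germ U fun a => Structure.funMap (L := caLang ι) f fun i => x i a :=
  Ultraproduct.funMap_cast (L := caLang ι) f x

theorem join_germ (x y : ∀ a, M a) :
    join ι (germ U x) (germ U y) = germ U fun a => join ι (x a) (y a) := by
  unfold join
  have e : ![germ U x, germ U y] = fun i => germ U (![x, y] i) := by
    funext i; fin_cases i <;> rfl
  rw [e, funMap_germ]
  refine congrArg (germ U) (funext fun a => congrArg _ ?_)
  funext i; fin_cases i <;> rfl

theorem meet_germ (x y : ∀ a, M a) :
    meet ι (germ U x) (germ U y) = germ U fun a => meet ι (x a) (y a) := by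
  unfold meet
  have e : ![germ U x, germ U y] = fun i => germ U (![x, y] i) := by
    funext i; fin_cases i <;> rfl
  rw [e, funMap_germ]
  refine congrArg (germ U) (funext fun a => congrArg _ ?_)
  funext i; fin_cases i <;> rfl

theorem neg_germ (x : ∀ a, M a) : neg ι (germ U x) = germ U fun a => neg ι (x a) := by
  unfold neg
  have e : ![germ U x] = fun i => germ U (![x] i) := by
    funext i; fin_cases i; rfl
  rw [e, funMap_germ]
  refine congrArg (germ U) (funext fun a => congrArg _ ?_)
  funext i; fin_cases i; rfl

theorem cyl_germ (i : ι) (x : ∀ a, M a) : cyl i (germ U x) = germ U fun a => cyl i (x a) := by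
  unfold cyl
  have e : ![germ U x] = fun i => germ U (![x] i) := by
    funext i; fin_cases i; rfl
  rw [e, funMap_germ]
  refine congrArg (germ U) (funext fun a => congrArg _ ?_)
  funext i; fin_cases i; rfl

theorem zero_germ : zero ι ((U : Filter α).Product M) = germ U fun a => zero ι (M a) := by
  unfold zero
  rw [Subsingleton.elim ![] (fun i : Fin 0 => germ U (i.elim0 : ∀ a, M a)), funMap_germ]
  exact congrArg (germ U) (funext fun a => congrArg _ (Subsingleton.elim _ _))

theorem one_germ : one ι ((U : Filter α).Product M) = germ U fun a => one ι (M a) := by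
  unfold one
  rw [Subsingleton.elim ![] (fun i : Fin 0 => germ U (i.elim0 : ∀ a, M a)), funMap_germ]
  exact congrArg (germ U) (funext fun a => congrArg _ (Subsingleton.elim _ _))

theorem diag_germ (i j : ι) :
    diag ((U : Filter α).Product M) i j = germ U fun a => diag (M a) i j := by
  unfold diag
  rw [Subsingleton.elim ![] (fun i : Fin 0 => germ U (i.elim0 : ∀ a, M a)), funMap_germ]
  exact congrArg (germ U) (funext fun a => congrArg _ (Subsingleton.elim _ _))

end Ultraproduct

/-! ### Ultraproducts of net algebras as neat reducts. -/

section NetProduct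

variable {U : Ultrafilter ℕ} {d : ℕ → ℕ} {κ : ℕ → Type u} {col : ∀ a, κ a → Fin (d a)}

/-- Only the axioms `diag_eq` and `cyl_diag` need their indices below the number of points. Each
instance involves at most three indices, so it holds in almost all factors. -/
theorem isCA_netProduct (hd : Filter.Tendsto d U Filter.atTop)
    (hcol : ∀ a, Function.Surjective (col a)) :
    IsCA ℕ ((U : Filter ℕ).Product fun a => NetAlg (d a) (col a)) := by
  have hlt : ∀ i, ∀ᶠ a in U, i < d a := fun i => hd.eventually_gt_atTop i
  have all : ∀ {P : ((U : Filter ℕ).Product fun a => NetAlg (d a) (col a)) → Prop},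
      (∀ x, P (germ U x)) → ∀ x, P x := fun h x => by
    obtain ⟨y, rfl⟩ := exists_germ_eq x
    exact h y
  constructor
  · refine all fun x => all fun y => ?_
    simp only [join_germ]
    congr 1; ext; simp [or_comm]
  · refine all fun x => all fun y => ?_
    simp only [meet_germ]
    congr 1; ext; simp [and_comm]
  · refine all fun x => all fun y => all fun z => ?_
    simp only [join_germ]
    congr 1; ext; simp [or_assoc]
  · refine all fun x => all fun y => all fun z => ?_
    simp only [meet_germ]
    congr 1; ext; simp [and_assoc]
  · refine all fun x => all fun y => ?_
    simp only [join_germ, meet_germ]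
    congr 1; ext; simp; tauto
  · refine all fun x => all fun y => ?_
    simp only [join_germ, meet_germ]
    congr 1; ext; simp; tauto
  · refine all fun x => all fun y => all fun z => ?_
    simp only [join_germ, meet_germ]
    congr 1; ext; simp; tauto
  · refine all fun x => ?_
    simp only [join_germ, zero_germ]
    congr 1; ext; simp
  · refine all fun x => ?_
    simp only [meet_germ, one_germ]
    congr 1; ext; simp
  · refine all fun x => ?_
    simp only [join_germ, neg_germ, one_germ]
    congr 1; ext; simp; tauto
  · refine all fun x => ?_
    simp only [meet_germ, neg_germ, zero_germ]
    congr 1; ext; simp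
  · intro i
    simp only [cyl_germ, zero_germ, NetAlg.cyl_zero]
  · refine fun i => all fun x => ?_
    simp only [cyl_germ, join_germ, NetAlg.le_cyl]
  · refine fun i => all fun x => all fun y => ?_
    simp only [cyl_germ, meet_germ, NetAlg.cyl_meet_cyl]
  · refine fun i j => all fun x => ?_
    simp only [cyl_germ]
    exact congrArg _ (funext fun a => NetAlg.cyl_comm (hcol a) i j (x a))
  · intro i
    simp only [diag_germ, one_germ, NetAlg.diag_self]
  · intro i j k hi hj
    simp only [diag_germ, meet_germ, cyl_germ, germ_eq]
    filter_upwards [hlt i, hlt j, hlt k] with a h1 h2 h3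
    exact NetAlg.diag_eq h1 h2 h3 hi hj
  · refine fun i j => all fun x => fun hij => ?_
    simp only [diag_germ, meet_germ, neg_germ, cyl_germ, zero_germ, germ_eq]
    filter_upwards [hlt i, hlt j] with a h1 h2
    exact NetAlg.cyl_diag h1 h2 hij (x a)

/-- The subalgebra of the ultraproduct formed by the elements of finite dimension. -/
def finDim (U : Ultrafilter ℕ) (hcol : ∀ a, Function.Surjective (col a)) :
    (caLang ℕ).Substructure ((U : Filter ℕ).Product fun a => NetAlg (d a) (col a)) where
  -- The bound `l` is the same for all factors. Without it, an element fixed by each `c_i` with `n ≤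
  -- i` need not have a representative whose coordinates are fixed by all of them at once.
  carrier := {x | ∃ (y : ∀ a, NetAlg (d a) (col a)) (l : ℕ), germ U y = x ∧
    ∀ a i, l ≤ i → cyl i (y a) = y a}
  fun_mem := by
    intro k f x hx
    choose y l hy hl using hx
    obtain rfl : (fun i => germ U (y i)) = x := funext hy
    refine ⟨fun a => Structure.funMap (L := caLang ℕ) f fun i => y i a, ?_⟩
    suffices h : ∃ l : ℕ, ∀ a i, l ≤ i →
        cyl i (Structure.funMap (L := caLang ℕ) f fun i => y i a) =
          Structure.funMap (L := caLang ℕ) f fun i => y i a by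
      obtain ⟨l, h⟩ := h
      exact ⟨l, (funMap_germ f y).symm, h⟩
    cases f with
    | join =>
      refine ⟨max (l 0) (l 1), fun a i hi => ?_⟩
      exact NetAlg.cyl_join_of_fixed (hl 0 a i (by omega)) (hl 1 a i (by omega))
    | meet =>
      refine ⟨max (l 0) (l 1), fun a i hi => ?_⟩
      exact NetAlg.cyl_meet_of_fixed (hl 0 a i (by omega)) (hl 1 a i (by omega))
    | neg => exact ⟨l 0, fun a i hi => NetAlg.cyl_neg_of_fixed (hl 0 a i hi)⟩
    | zero => exact ⟨0, fun a i hi => NetAlg.cyl_zero i⟩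
    | one => exact ⟨0, fun a i hi => NetAlg.cyl_one i⟩
    | cyl j =>
      refine ⟨l 0, fun a i hi => ?_⟩
      change cyl i (cyl j (y 0 a)) = cyl j (y 0 a)
      rw [NetAlg.cyl_comm (hcol a), hl 0 a i hi]
    | diag j k =>
      exact ⟨max j k + 1, fun a i hi =>
        NetAlg.cyl_diag_of_ne (i := j) (j := k) (by omega) (by omega)⟩

theorem isCA_finDim (hd : Filter.Tendsto d U Filter.atTop)
    (hcol : ∀ a, Function.Surjective (col a)) : IsCA ℕ (finDim U hcol) :=
  (isCA_netProduct hd hcol).of_injective _ Subtype.val_injective fun _ _ _ => rfl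

end NetProduct


section

variable {m : ℕ} {κ : Type u}

/-- The universe of `netReduct`. -/
def NetReduct (n : ℕ) {col : κ → Fin m} (hcol : Function.Surjective col) : Type u :=
  letI := (finLHom n).reduct (NetAlg m col)
  netReduct n hcol

instance (n : ℕ) {col : κ → Fin m} (hcol : Function.Surjective col) :
    (caLang (Fin n)).Structure (NetReduct n hcol) :=
  letI := (finLHom n).reduct (NetAlg m col)
  inferInstanceAs ((caLang (Fin n)).Structure (netReduct n hcol))

instance (n : ℕ) {col : κ → Fin m} (hcol : Function.Surjective col) :
    Inhabited (NetReduct n hcol) :=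
  ⟨⟨zero ℕ (NetAlg m col), fun i _ => NetAlg.cyl_zero i⟩⟩

instance [Finite κ] (n : ℕ) {col : κ → Fin m} (hcol : Function.Surjective col) :
    Finite (NetReduct n hcol) :=
  inferInstanceAs (Finite {X : NetAlg m col // ∀ i : ℕ, n ≤ i → cyl i X = X})

end

section

variable {U : Ultrafilter ℕ} {d : ℕ → ℕ} {κ : ℕ → Type u} {col : ∀ a, κ a → Fin (d a)}

theorem netReduct_product_mem_NrCAOmega (n : ℕ) (hd : Filter.Tendsto d U Filter.atTop)
    (hcol : ∀ a, Function.Surjective (col a)) :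
    (⟨(U : Filter ℕ).Product fun a => NetReduct n (hcol a), inferInstance⟩ :
      Bundled.{u} (caLang (Fin n)).Structure) ∈ NrCAOmega n := by
  have hB := isCA_finDim hd hcol
  refine ⟨⟨finDim U hcol, inferInstance⟩, hB, ?_⟩
  let := (finLHom n).reduct (finDim U hcol)
  have hP : ∀ y : ∀ a, NetReduct n (hcol a), ∃ z : neatReduct n (finDim U hcol) hB,
      z.1.1 = germ U fun a => (y a).1 := fun y => by
    refine ⟨⟨⟨germ U fun a => (y a).1, fun a => (y a).1, n, rfl, fun a => (y a).2⟩, ?_⟩, rfl⟩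
    intro i hi
    apply Subtype.ext
    change cyl i (germ U fun a => ((y a).1 : NetAlg (d a) (col a))) = germ U fun a => (y a).1
    rw [cyl_germ]
    exact congrArg _ (funext fun a => (y a).2 i hi)
  choose F hF using hP
  have hFcong : ∀ y y', F y = F y' ↔ germ U y = germ U y' := fun y y' => by
    rw [Subtype.ext_iff, Subtype.ext_iff, hF, hF, germ_eq, germ_eq]
    exact Filter.eventually_congr (.of_forall fun a => Subtype.ext_iff.symm)
  let G : ((U : Filter ℕ).Product fun a => NetReduct n (hcol a)) →
      neatReduct n (finDim U hcol) hB :=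
    Quotient.lift F fun y y' h => (hFcong y y').2 (Quotient.sound h)
  have hG : ∀ y, G (germ U y) = F y := fun _ => rfl
  have hbij : Function.Bijective G := by
    constructor
    · intro x x' h
      obtain ⟨y, rfl⟩ := exists_germ_eq x
      obtain ⟨y', rfl⟩ := exists_germ_eq x'
      exact (hFcong y y').1 h
    · rintro ⟨⟨_, y, l, rfl, hl⟩, hx⟩
      have h1 : ∀ i, n ≤ i → ∀ᶠ a in U, cyl i (y a) = y a := fun i hi => by
        have := congrArg Subtype.val (hx i hi)
        change cyl i (germ U y) = germ U y at this
        rwa [cyl_germ, germ_eq] at this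
      -- From `l` on the coordinates are fixed everywhere, so only finitely many conditions remain
      -- to be intersected.
      have h2 : ∀ᶠ a in U, ∀ i ∈ Set.Ico n l, cyl i (y a) = y a :=
        (Filter.eventually_all_finite (Set.finite_Ico n l)).2 fun i hi => h1 i hi.1
      have h3 : ∀ᶠ a in U, ∀ i, n ≤ i → cyl i (y a) = y a := by
        filter_upwards [h2] with a ha i hi
        by_cases h : i < l
        · exact ha i ⟨hi, h⟩
        · exact hl a i (by omega)
      have h4 : ∀ a, ∃ z : NetReduct n (hcol a),
          (∀ i, n ≤ i → cyl i (y a) = y a) → z.1 = y a := fun a => by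
        by_cases h : ∀ i, n ≤ i → cyl i (y a) = y a
        · exact ⟨⟨y a, h⟩, fun _ => rfl⟩
        · exact ⟨default, fun h' => absurd h' h⟩
      choose z hz using h4
      refine ⟨germ U z, ?_⟩
      rw [hG]
      apply Subtype.ext
      apply Subtype.ext
      rw [hF, germ_eq]
      filter_upwards [h3] with a ha
      exact hz a ha
  refine ⟨⟨Equiv.ofBijective G hbij, ?_, fun r => r.elim⟩⟩
  intro k f x
  choose y hy using fun i => exists_germ_eq (x i)
  obtain rfl : (fun i => germ U (y i)) = x := funext hy
  change G (Structure.funMap (L := caLang (Fin n)) f fun i => germ U (y i)) = _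
  rw [funMap_germ, hG]
  apply Subtype.ext
  apply Subtype.ext
  rw [hF]
  refine (funMap_germ (U := U) ((finLHom n).onFunction f) fun i a => (y i a).1).symm.trans ?_
  refine congrArg (Structure.funMap (L := caLang ℕ) ((finLHom n).onFunction f)) ?_
  funext i
  exact (hF (y i)).symm

end


/-! ### Describing a finite algebra by one sentence. -/

instance (n k : ℕ) : Finite (CAFunc (Fin n) k) := by
  let f : CAFunc (Fin n) k → Fin 5 ⊕ Fin n ⊕ Fin n × Fin n := fun
    | .join => .inl 0
    | .meet => .inl 1
    | .neg => .inl 2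
    | .zero => .inl 3
    | .one => .inl 4
    | .cyl i => .inr (.inl i)
    | .diag i j => .inr (.inr (i, j))
  refine Finite.of_injective f fun x y h => ?_
  cases x <;> cases y <;> simp_all [f]

theorem CAFunc.arity_lt {ι : Type} {k : ℕ} (f : CAFunc ι k) : k < 3 := by
  cases f <;> decide

/-- A sentence that holds exactly in the extensions of copies of a finite algebra. -/
theorem exists_sentence_of_finite (n : ℕ) (A : Type u) [(caLang (Fin n)).Structure A] [Finite A] :
    ∃ φ : (caLang (Fin n)).Sentence, A ⊨ φ ∧
      ∀ (M : Type u) [(caLang (Fin n)).Structure M], M ⊨ φ → Nonempty (A ↪[caLang (Fin n)] M) := by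
  -- The positive diagram `E` and the inequalities `D` of `A`, with its elements as variables. All
  -- arities are below 3, which makes the conjunction finite.
  let E : (Σ k : Fin 3, CAFunc (Fin n) k × (Fin k → A)) →
      (caLang (Fin n)).Formula (Empty ⊕ A) := fun p =>
    Term.equal
      (Term.func (L := caLang (Fin n)) p.2.1 fun i => Term.var (Sum.inr (p.2.2 i)))
      (Term.var (Sum.inr (Structure.funMap (L := caLang (Fin n)) p.2.1 p.2.2)))
  let D : {p : A × A // p.1 ≠ p.2} → (caLang (Fin n)).Formula (Empty ⊕ A) := fun p =>
    ∼(Term.equal (Term.var (Sum.inr p.1.1)) (Term.var (Sum.inr p.1.2)))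
  have key : ∀ (M : Type u) [(caLang (Fin n)).Structure M] (v : Empty ⊕ A → M),
      (Formula.iInf E ⊓ Formula.iInf D).Realize v ↔
        (∀ p : Σ k : Fin 3, CAFunc (Fin n) k × (Fin k → A),
          Structure.funMap (L := caLang (Fin n)) p.2.1 (fun i => v (Sum.inr (p.2.2 i))) =
            v (Sum.inr (Structure.funMap (L := caLang (Fin n)) p.2.1 p.2.2))) ∧
        ∀ p : {p : A × A // p.1 ≠ p.2}, v (Sum.inr p.1.1) ≠ v (Sum.inr p.1.2) := by
    intro M _ v
    rw [Formula.realize_inf, Formula.realize_iInf, Formula.realize_iInf]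
    simp only [E, D, Formula.realize_equal, Formula.realize_not, Term.realize, ne_eq]
  refine ⟨Formula.iExs A (Formula.iInf E ⊓ Formula.iInf D), ?_, ?_⟩
  · rw [Sentence.Realize, Formula.realize_iExs]
    refine ⟨id, ?_⟩
    rw [key]
    exact ⟨fun _ => rfl, fun p => p.2⟩
  · intro M _ h
    rw [Sentence.Realize, Formula.realize_iExs] at h
    obtain ⟨i, hi⟩ := h
    rw [key] at hi
    refine ⟨⟨⟨i, fun x y hxy => ?_⟩, fun {k} f x => ?_, fun r => r.elim⟩⟩
    · by_contra hne
      exact hi.2 ⟨(x, y), hne⟩ hxy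
    · exact (hi.1 ⟨⟨k, CAFunc.arity_lt f⟩, f, x⟩).symm

end CA

/-- A form of Ramsey's theorem for triangles: if any two points of a large finite set are related
by one of `k` relations, one of the relations has a transitive triangle. -/
theorem exists_card_lt_of_no_triangle (k : ℕ) : ∃ N : ℕ, ∀ (γ : Type) (V : Type u) (C : Finset γ)
    (R : γ → V → V → Prop) (S : Finset V), C.card = k →
    (∀ x ∈ S, ∀ y ∈ S, x ≠ y → ∃ c ∈ C, R c x y) →
    (∀ c x y z, R c x y → R c y z → ¬ R c x z) → S.card < N := by
  classical
  induction k with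
  | zero =>
    refine ⟨2, fun γ V C R S hC hR _ => ?_⟩
    by_contra! h
    obtain ⟨x, hx, y, hy, hxy⟩ := Finset.one_lt_card.1 (show 1 < S.card by omega)
    obtain ⟨c, hc, _⟩ := hR x hx y hy hxy
    rw [Finset.card_eq_zero.1 hC] at hc
    simp at hc
  | succ k ih =>
    obtain ⟨N, hN⟩ := ih
    refine ⟨(k + 1) * N + 2, fun γ V C R S hC hR hT => ?_⟩
    by_contra! h
    obtain ⟨v, hv⟩ : S.Nonempty := Finset.card_pos.1 (by omega)
    have hsub : S.erase v ⊆ C.biUnion fun c => (S.erase v).filter fun y => R c v y := by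
      intro y hy
      obtain ⟨hyv, hyS⟩ := Finset.mem_erase.1 hy
      obtain ⟨c, hc, hcy⟩ := hR v hv y hyS hyv.symm
      exact Finset.mem_biUnion.2 ⟨c, hc, Finset.mem_filter.2 ⟨hy, hcy⟩⟩
    have hle : (S.erase v).card ≤ (k + 1) * N := by
      refine (Finset.card_le_card hsub).trans ?_
      rw [← hC]
      -- Two points joined to `v` by `c` cannot be related by `c`, so induction applies to them with
      -- the remaining `k` relations.
      refine Finset.card_biUnion_le_card_mul _ _ _ fun c hc => (hN γ V (C.erase c) R _ ?_ ?_ hT).le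
      · rw [Finset.card_erase_of_mem hc, hC]; rfl
      · intro x hx y hy hxy
        simp only [Finset.mem_filter, Finset.mem_erase] at hx hy
        obtain ⟨e, he, hexy⟩ := hR x hx.1.2 y hy.1.2 hxy
        refine ⟨e, Finset.mem_erase.2 ⟨?_, he⟩, hexy⟩
        rintro rfl
        exact hT _ _ _ _ hx.2 hexy hy.2
    rw [Finset.card_erase_of_mem hv] at hle
    omega

/-! ### Net algebras with many labels are not representable. -/

namespace CA

section Maps

variable {ι : Type} {A : Type u} {B : Type v} [(caLang ι).Structure A] [(caLang ι).Structure B]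
  (h : A →[caLang ι] B)

theorem map_join (x y : A) : h (join ι x y) = join ι (h x) (h y) := by
  unfold join
  rw [Hom.map_fun]
  exact congrArg _ (by funext a; fin_cases a <;> rfl)

theorem map_meet (x y : A) : h (meet ι x y) = meet ι (h x) (h y) := by
  unfold meet
  rw [Hom.map_fun]
  exact congrArg _ (by funext a; fin_cases a <;> rfl)

theorem map_neg (x : A) : h (neg ι x) = neg ι (h x) := by
  unfold neg
  rw [Hom.map_fun]
  exact congrArg _ (by funext a; fin_cases a; rfl)

theorem map_cyl (i : ι) (x : A) : h (cyl i x) = cyl i (h x) := by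
  unfold cyl
  rw [Hom.map_fun]
  exact congrArg _ (by funext a; fin_cases a; rfl)

theorem map_zero : h (zero ι A) = zero ι B := by
  unfold zero
  rw [Hom.map_fun]
  exact congrArg _ (Subsingleton.elim _ _)

theorem map_one : h (one ι A) = one ι B := by
  unfold one
  rw [Hom.map_fun]
  exact congrArg _ (Subsingleton.elim _ _)

theorem map_diag (i j : ι) : h (diag A i j) = diag B i j := by
  unfold diag
  rw [Hom.map_fun]
  exact congrArg _ (Subsingleton.elim _ _)

end Maps

/-- The `k`-th projection of a direct product. -/
def DirectProd.proj (ι : Type) {I : Type v} (M : I → Type u) [∀ k, (caLang ι).Structure (M k)]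
    (k : I) : DirectProd M →[caLang ι] M k where
  toFun := fun x => x k
  map_fun' := fun _ _ => rfl
  map_rel' := fun r => r.elim

namespace FullCs

variable {ι : Type} {U : Type u} {X Y : FullCs ι U} {t : ι → U}

instance : Membership (ι → U) (FullCs ι U) := inferInstanceAs (Membership _ (Set _))

theorem ext (h : ∀ t, t ∈ X ↔ t ∈ Y) : X = Y := Set.ext h

theorem mem_meet : t ∈ meet ι X Y ↔ t ∈ X ∧ t ∈ Y := Iff.rfl
theorem not_mem_zero : t ∉ zero ι (FullCs ι U) := fun h => h
theorem mem_one : t ∈ one ι (FullCs ι U) := trivial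

end FullCs

section

variable {m n : ℕ} {κ : Type u} {col : κ → Fin m} (hcol : Function.Surjective col)

/-- The element `{ρ | ρ 0 1 ∈ P}` of the algebra of sets of nets. -/
def edge (hm : 2 < m) (hn : 2 < n) (P : Set κ) : NetReduct n hcol :=
  ⟨({ρ | ∃ x ∈ P, ρ.1 ⟨0, by omega⟩ ⟨1, by omega⟩ = some x} : Set (Net m col)), by
    intro i hi
    ext ρ
    constructor
    · rintro ⟨σ, ⟨x, hx, hσ⟩, h⟩
      exact ⟨x, hx, by rw [← hσ, h _ _ (by simp; omega) (by simp; omega)]⟩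
    · exact fun h => ⟨ρ, h, AgreeOff.refl _ _⟩⟩

variable {hcol} (hm : 2 < m) (hn : 2 < n) (P Q : Set κ)

instance : Membership (Net m col) (NetReduct n hcol) := ⟨fun X ρ => ρ ∈ X.1⟩

namespace NetReduct

variable {X Y : NetReduct n hcol} {ρ : Net m col}

theorem ext (h : ∀ ρ, ρ ∈ X ↔ ρ ∈ Y) : X = Y := Subtype.ext (NetAlg.ext h)

theorem mem_join : ρ ∈ join (Fin n) X Y ↔ ρ ∈ X ∨ ρ ∈ Y := Iff.rfl
theorem mem_meet : ρ ∈ meet (Fin n) X Y ↔ ρ ∈ X ∧ ρ ∈ Y := Iff.rfl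
theorem mem_neg : ρ ∈ neg (Fin n) X ↔ ρ ∉ X := Iff.rfl
theorem not_mem_zero : ρ ∉ zero (Fin n) (NetReduct n hcol) := fun h => h
theorem mem_one : ρ ∈ one (Fin n) (NetReduct n hcol) := trivial
theorem mem_diag {i j : Fin n} : ρ ∈ diag (NetReduct n hcol) i j ↔
    ∀ a b : Fin m, (a : ℕ) = i → (b : ℕ) = j → ρ.1 a b = none := Iff.rfl
theorem mem_edge : ρ ∈ edge hcol hm hn P ↔
    ∃ x ∈ P, ρ.1 ⟨0, by omega⟩ ⟨1, by omega⟩ = some x := Iff.rfl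

end NetReduct

open NetReduct

theorem edge_union :
    edge hcol hm hn (P ∪ Q) = join (Fin n) (edge hcol hm hn P) (edge hcol hm hn Q) := by
  apply NetReduct.ext
  intro ρ
  simp only [mem_join, mem_edge, Set.mem_union]
  grind

theorem edge_empty : edge hcol hm hn ∅ = zero (Fin n) _ := by
  apply NetReduct.ext
  intro ρ
  simp [mem_edge, not_mem_zero]

theorem edge_univ :
    edge hcol hm hn Set.univ = neg (Fin n) (diag _ (⟨0, by omega⟩ : Fin n) (⟨1, by omega⟩ : Fin n)) := by
  apply NetReduct.ext
  intro ρ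
  simp only [mem_edge, mem_neg, mem_diag, Set.mem_univ, true_and]
  rw [← Option.ne_none_iff_exists', not_iff_not]
  refine ⟨fun h a b ha hb => ?_, fun h => h _ _ rfl rfl⟩
  have ha' : a = ⟨0, by omega⟩ := Fin.ext ha
  have hb' : b = ⟨1, by omega⟩ := Fin.ext hb
  exact ha' ▸ hb' ▸ h

theorem meet_edge (hPQ : Disjoint P Q) :
    meet (Fin n) (edge hcol hm hn P) (edge hcol hm hn Q) = zero (Fin n) _ := by
  apply NetReduct.ext
  intro ρ
  simp only [mem_edge, mem_meet, not_mem_zero, iff_false]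
  rintro ⟨⟨x, hx, h⟩, y, hy, h'⟩
  rw [h, Option.some_inj] at h'
  exact Set.disjoint_left.1 hPQ hx (h' ▸ hy)

theorem cyl_edge_of_two_le {i : Fin n} (hi : 2 ≤ (i : ℕ)) :
    cyl i (edge hcol hm hn P) = edge hcol hm hn P := by
  apply NetReduct.ext
  intro ρ
  constructor
  · rintro ⟨σ, ⟨x, hx, hσ⟩, h⟩
    exact ⟨x, hx, by rw [← hσ, h _ _ (by simp; omega) (by simp; omega)]⟩
  · exact fun h => ⟨ρ, h, AgreeOff.refl _ _⟩

theorem cyl_edge_one (x : κ) :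
    cyl (⟨1, by omega⟩ : Fin n) (edge hcol hm hn {x}) = one (Fin n) _ := by
  apply NetReduct.ext
  intro ρ
  refine ⟨fun _ => trivial, fun _ => ?_⟩
  obtain ⟨σ, h1, h2⟩ := exists_agreeOff_label hcol ρ (i := ⟨0, by omega⟩) (j := ⟨1, by omega⟩)
    (by simp) x
  exact ⟨σ, ⟨x, rfl, h2⟩, h1⟩

/-- The term `c_1(d_12 · X)` evaluates `X` at the points `0, 2`, and a further substitution of `1`
for `0` evaluates it at `1, 2`. The equation thus forbids monochromatic triangles in the language of
dimension at least three. -/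
theorem edge_triangle (c : Fin m) :
    meet (Fin n) (edge hcol hm hn (col ⁻¹' {c}))
      (meet (Fin n)
        (cyl (⟨1, by omega⟩ : Fin n) (meet (Fin n) (diag _ (⟨1, by omega⟩ : Fin n) (⟨2, by omega⟩ : Fin n))
          (edge hcol hm hn (col ⁻¹' {c}))))
        (cyl (⟨0, by omega⟩ : Fin n) (meet (Fin n) (diag _ (⟨0, by omega⟩ : Fin n) (⟨1, by omega⟩ : Fin n))
          (cyl (⟨1, by omega⟩ : Fin n) (meet (Fin n) (diag _ (⟨1, by omega⟩ : Fin n) (⟨2, by omega⟩ : Fin n))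
            (edge hcol hm hn (col ⁻¹' {c}))))))) = zero (Fin n) _ := by
  apply NetReduct.ext
  intro ρ
  have key : ∀ ρ : Net m col, ρ ∈ cyl (⟨1, by omega⟩ : Fin n)
      (meet (Fin n) (diag _ (⟨1, by omega⟩ : Fin n) (⟨2, by omega⟩ : Fin n)) (edge hcol hm hn (col ⁻¹' {c}))) →
      ∃ x, col x = c ∧ ρ.1 ⟨0, by omega⟩ ⟨2, by omega⟩ = some x := by
    rintro ρ ⟨σ, ⟨h1, x, hx, h2⟩, h3⟩
    refine ⟨x, hx, ?_⟩
    rw [← h3 _ _ (by simp) (by simp), ← h2, σ.2.symm, σ.2.symm ⟨0, _⟩ ⟨1, _⟩]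
    exact (σ.2.congr _ _ _ (h1 ⟨1, by omega⟩ ⟨2, by omega⟩ rfl rfl)).symm
  refine ⟨?_, fun h => h.elim⟩
  rintro ⟨⟨x, hx, h1⟩, h2, σ, ⟨h3, h4⟩, h5⟩
  obtain ⟨y, hy, h2⟩ := key ρ h2
  obtain ⟨z, hz, h4⟩ := key σ h4
  rw [σ.2.congr _ _ _ (h3 ⟨0, by omega⟩ ⟨1, by omega⟩ rfl rfl),
    h5 _ _ (by simp) (by simp)] at h4
  exact ρ.2.triangle _ _ _ x z y h1 h4 h2 (hx.trans hz.symm) (hx.trans hy.symm)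

end


section

variable {m n : ℕ} {κ : Type u} {col : κ → Fin m} {hcol : Function.Surjective col}

/-- If the net algebra has a homomorphism to a set algebra, its base has a triangle-free colouring by
`m` colours, and one point of the base has a different neighbour for each label. -/
theorem exists_coloring_of_hom (hm : 2 < m) (hn : 2 < n) {V : Type u} [Nonempty V]
    (h : NetReduct n hcol →[caLang (Fin n)] FullCs (Fin n) V) :
    ∃ R : Fin m → V → V → Prop, (∀ x y, x ≠ y → ∃ c, R c x y) ∧
      (∀ c x y z, R c x y → R c y z → ¬ R c x z) ∧ ∃ f : κ → V, Function.Injective f := by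
  obtain ⟨o⟩ := ‹Nonempty V›
  let i0 : Fin n := ⟨0, by omega⟩
  let i1 : Fin n := ⟨1, by omega⟩
  let i2 : Fin n := ⟨2, by omega⟩
  have h01 : i0 ≠ i1 := by simp [i0, i1]
  have h02 : i0 ≠ i2 := by simp [i0, i2]
  have h12 : i1 ≠ i2 := by simp [i1, i2]
  -- Only the first three coordinates matter; the rest are filled with the base point `o`.
  let t : V → V → V → Fin n → V := fun x y z i =>
    if i = i0 then x else if i = i1 then y else if i = i2 then z else o
  have t0 : ∀ x y z, t x y z i0 = x := fun x y z => by simp [t]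
  have t1 : ∀ x y z, t x y z i1 = y := fun x y z => by simp [t, h01.symm]
  have t2 : ∀ x y z, t x y z i2 = z := fun x y z => by simp [t, h02.symm, h12.symm]
  have u0 : ∀ x x' y z j, j ≠ i0 → t x y z j = t x' y z j := fun x x' y z j hj => by simp [t, hj]
  have u1 : ∀ x y y' z j, j ≠ i1 → t x y z j = t x y' z j := fun x y y' z j hj => by simp [t, hj]
  have u2 : ∀ x y z z' j, j ≠ i2 → t x y z j = t x y z' j := fun x y z z' j hj => by simp [t, hj]
  let e : Set κ → NetReduct n hcol := edge hcol hm hn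
  have he2 : ∀ P x y z z', t x y z ∈ h (e P) → t x y z' ∈ h (e P) := fun P x y z z' ht => by
    have := cyl_edge_of_two_le (hcol := hcol) (i := i2) hm hn P (le_refl 2)
    change t x y z' ∈ h (edge hcol hm hn P)
    rw [← this, map_cyl]
    exact ⟨_, ht, u2 _ _ _ _⟩
  have hdisj : ∀ P Q s, Disjoint P Q → s ∈ h (e P) → s ∉ h (e Q) := fun P Q s hPQ hP hQ => by
    have := map_meet h (e P) (e Q)
    rw [meet_edge hm hn P Q hPQ, map_zero] at this
    exact FullCs.not_mem_zero (this ▸ FullCs.mem_meet.2 ⟨hP, hQ⟩ : s ∈ zero (Fin n) (FullCs _ V))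
  have hfin : ∀ (C : Finset (Fin m)) s, s ∈ h (e (col ⁻¹' C)) → ∃ c, s ∈ h (e (col ⁻¹' {c})) := by
    classical
    intro C
    induction C using Finset.induction_on with
    | empty =>
      intro s hs
      rw [Finset.coe_empty, Set.preimage_empty] at hs
      simp only [e, edge_empty, map_zero] at hs
      exact (FullCs.not_mem_zero hs).elim
    | insert c C _ ih =>
      intro s hs
      rw [Finset.coe_insert, Set.insert_eq, Set.preimage_union] at hs
      simp only [e, edge_union, map_join] at hs
      exact hs.elim (fun hs => ⟨c, hs⟩) (ih s)
  refine ⟨fun c x y => t x y o ∈ h (e (col ⁻¹' {c})), ?_, ?_, ?_⟩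
  · intro x y hxy
    apply hfin Finset.univ
    rw [Finset.coe_univ, Set.preimage_univ]
    simp only [e, edge_univ, map_neg, map_diag]
    intro hd
    exact hxy (((t0 x y o).symm.trans hd).trans (t1 x y o))
  · intro c x y z hxy hyz hxz
    have key : ∀ x y z, t x z o ∈ h (e (col ⁻¹' {c})) → t x y z ∈ h (cyl i1
        (meet (Fin n) (diag _ i1 i2) (e (col ⁻¹' {c})))) := fun x y z ht => by
      rw [map_cyl, map_meet, map_diag]
      refine ⟨t x z z, ⟨(t1 x z z).trans (t2 x z z).symm, he2 _ _ _ _ _ ht⟩, u1 _ _ _ _⟩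
    have := congrArg h (edge_triangle (hcol := hcol) hm hn c)
    rw [map_zero, map_meet, map_meet] at this
    refine FullCs.not_mem_zero (t := t x y z) (this ▸ FullCs.mem_meet.2
      ⟨he2 _ _ _ _ _ hxy, FullCs.mem_meet.2 ⟨key x y z hxz, ?_⟩⟩)
    rw [map_cyl, map_meet, map_diag]
    exact ⟨t y y z, ⟨(t0 y y z).trans (t1 y y z).symm, key y y z hyz⟩, u0 _ _ _ _⟩
  -- Since `c_1` of the edge element of `x` is the unit, the constant tuple `o` can be changed at
  -- coordinate 1 to lie on an `x`-edge. Edge elements of distinct labels are disjoint, so the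
  -- endpoints differ.
  · have hex : ∀ x : κ, ∃ v, t o v o ∈ h (e {x}) := fun x => by
      have h1 : t o o o ∈ h (one (Fin n) _) := by
        rw [map_one]; exact FullCs.mem_one
      rw [← cyl_edge_one hm hn x, map_cyl] at h1
      obtain ⟨s, hs, hst⟩ := h1
      refine ⟨s i1, ?_⟩
      have : t o (s i1) o = s := by
        funext j
        by_cases hj : j = i1
        · rw [hj, t1]
        · rw [hst j hj, u1 o o _ o j hj]
      rw [this]
      exact hs
    choose f hf using hex
    refine ⟨f, fun x y hxy => ?_⟩
    by_contra hne
    have := hf y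
    rw [← hxy] at this
    exact hdisj {x} {y} _ (Set.disjoint_singleton.2 hne) (hf x) this

theorem not_mem_RCA_of_card_le (hm : 2 < m) (hn : 2 < n) {N : ℕ} [Fintype κ]
    (hN : ∀ (V : Type u) (C : Finset (Fin m)) (R : Fin m → V → V → Prop) (S : Finset V),
      C.card = m → (∀ x ∈ S, ∀ y ∈ S, x ≠ y → ∃ c ∈ C, R c x y) →
      (∀ c x y z, R c x y → R c y z → ¬ R c x z) → S.card < N)
    (hκ : N ≤ Fintype.card κ) :
    (⟨NetReduct n hcol, inferInstance⟩ : Bundled.{u} (caLang (Fin n)).Structure) ∉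
      RCA (Fin n) := by
  rintro ⟨I, V, ⟨f⟩⟩
  have hne : zero (Fin n) (NetReduct n hcol) ≠ one (Fin n) (NetReduct n hcol) := fun h => by
    have ρ : Net m col := ⟨fun _ _ => none, fun _ => rfl, fun _ _ => rfl, fun _ _ _ _ => rfl,
      fun _ _ _ _ _ _ h => by cases h⟩
    exact NetReduct.not_mem_zero (h ▸ NetReduct.mem_one : ρ ∈ zero (Fin n) (NetReduct n hcol))
  -- Over empty bases only, the product would have one element, whereas the net algebra has two
  -- distinct constants.
  have hV : ∃ k, Nonempty (V k) := by
    by_contra! hV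
    refine hne (f.injective ?_)
    funext k
    apply FullCs.ext
    intro s
    exact ((hV k).false (s ⟨0, by omega⟩)).elim
  obtain ⟨k, hk⟩ := hV
  obtain ⟨R, h1, h2, g, hg⟩ := exists_coloring_of_hom hm hn
    ((DirectProd.proj (Fin n) (fun k => FullCs (Fin n) (V k)) k).comp f.toHom)
  have := hN (V k) Finset.univ R (Finset.univ.map ⟨g, hg⟩) (by simp)
    (fun x _ y _ hxy => (h1 x y hxy).imp fun c hc => ⟨Finset.mem_univ c, hc⟩) h2
  rw [Finset.card_map, Finset.card_univ] at this
  omega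

end

/-- `RCA_n` is closed under subalgebras. -/
theorem RCA.of_embedding {ι : Type} {A M : Bundled.{u} (caLang ι).Structure} (hM : M ∈ RCA ι)
    (f : A ↪[caLang ι] M) : A ∈ RCA ι := by
  obtain ⟨I, V, ⟨g⟩⟩ := hM
  exact ⟨I, V, ⟨g.comp f⟩⟩

end CA

/-! ### The main theorem. -/

open CA in
theorem mainTheorem2 (n : ℕ) (hn : 2 < n)
    (K : Set (CategoryTheory.Bundled.{u} (caLang (Fin n)).Structure))
    (hNr : CA.NrCAOmega n ⊆ K) (hR : K ⊆ CA.RCA (Fin n)) :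
    ¬ IsFinitelyAxiomatizable (elementaryClosure K) := by
  rintro ⟨T, hT, hKT⟩
  choose N hN using exists_card_lt_of_no_triangle.{u}
  -- Each of the `n + a` colours gets one label more than the Ramsey bound: every colour then
  -- occurs, even if the bound is zero, and the labels outnumber the bound.
  let κ : ℕ → Type u := fun a => ULift.{u} (Fin (n + a) × Fin (N (n + a) + 1))
  let col : ∀ a, κ a → Fin (n + a) := fun a x => x.down.1
  have hcol : ∀ a, Function.Surjective (col a) := fun a c => ⟨⟨(c, 0)⟩, rfl⟩
  let A : ℕ → Bundled.{u} (caLang (Fin n)).Structure := fun a =>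
    ⟨NetReduct n (hcol a), inferInstance⟩
  have hA : ∀ a, A a ∉ RCA (Fin n) := fun a => by
    refine not_mem_RCA_of_card_le (by omega) hn (fun V C R S => hN (n + a) (Fin (n + a)) V C R S) ?_
    rw [Fintype.card_ulift, Fintype.card_prod, Fintype.card_fin, Fintype.card_fin]
    nlinarith
  have hd : Filter.Tendsto (fun a => n + a) (Filter.hyperfilter ℕ : Filter ℕ) Filter.atTop :=
    (Filter.tendsto_atTop_mono (fun a => Nat.le_add_left a n) Filter.tendsto_id).mono_left
      Nat.hyperfilter_le_atTop
  have hP := hNr (netReduct_product_mem_NrCAOmega n hd hcol)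
  have hPT := show _ ∈ elementaryClosure K from ⟨fun φ hφ => hφ _ hP⟩
  rw [hKT] at hPT
  have hev : ∀ᶠ a in (Filter.hyperfilter ℕ : Filter ℕ), ∀ φ ∈ T, NetReduct n (hcol a) ⊨ φ :=
    (Filter.eventually_all_finite hT).2 fun φ hφ =>
      (Ultraproduct.sentence_realize φ).1 (hPT.realize_of_mem φ hφ)
  obtain ⟨a, ha⟩ := hev.exists
  have hAT : A a ∈ modelsOf T := ⟨fun φ hφ => ha φ hφ⟩
  rw [← hKT] at hAT
  obtain ⟨φ, h1, h2⟩ := exists_sentence_of_finite n (NetReduct n (hcol a))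
  -- A member of `K` satisfying `φ` would contain a copy of `A a`, making it representable.
  have h3 : ∼φ ∈ theoryOf K := fun M hM => by
    rw [Sentence.realize_not]
    intro h
    obtain ⟨f⟩ := h2 M h
    exact hA a (RCA.of_embedding (hR hM) f)
  have h4 := hAT.realize_of_mem _ h3
  rw [Sentence.realize_not] at h4
  exact h4 h1
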